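/- Consider a $K$-user energy harvesting Gaussian multiple access channel with output $Y_t = X_{1t}+\dots+X_{Kt}+N_t$, where the $N_t$ are i.i.d. $\mathcal N(0,1)$. Transmitter $i$ has a battery of finite capacity $\bar B_i$, and its input must satisfy $|X_{it}|^2 \le B_{it}$, where $B_{it} = \min\{B_{i(t-1)} - |X_{i(t-1)}|^2 + E_{it}, \bar B_i\}$ for $t \ge 1$, with $B_{i0} = X_{i0} = 0$. The energy arrival vectors $(E_{1t},\dots,E_{Kt})$ are independent of the noise and of the messages, and are i.i.d. across $t$ with an arbitrary joint probability mass function on $\mathcal E_1\times\dots\times\mathcal E_K$, where each $\mathcal E_i \subseteq [0,\bar B_i]$ is finite and $\mathbb E[E_i] > 0$. For nonnegative rates $R_1,\dots,R_K$, a $((2^{nR_1},\dots,2^{nR_K}),n)$ code has message sets $\mathcal W_i = \{1,\dots,\lfloor 2^{nR_i}\rfloor\}$, encoding functions $f_{it}:\mathcal W_i\times\mathcal E_i^t\to\mathbb R$ for $t=1,\dots,n$, with $X_{it} = f_{it}(W_i,E_i^t)$, that satisfy the energy constraints for all messages and all arrival sequences, and a measurable decoder $g$. The decoder estimates $(W_1,\dots,W_K)$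 from $Y^n$ alone (case Tx) or from $Y^n$ together with all arrivals $(E_1^n,\dots,E_K^n)$ (case TxRx). A tuple $(R_1,\dots,R_K)$ of nonnegative reals is achievable if there is a sequence of such codes ($n=1,2,\dots$) whose average probability of error, for messages uniform on $\mathcal W_1\times\dots\times\mathcal W_K$, tends to $0$. The capacity regions $\mathcal C^{\mathrm{Tx}}$ and $\mathcal C^{\mathrm{TxRx}}$ are the closures in $\mathbb R^K$ of the sets of achievable tuples in the two cases. **Proposition.** $\mathcal C^{\mathrm{Tx}} \subseteq \mathcal C^{\mathrm{TxRx}} \subseteq \overline{\mathcal C}$, where $$\overline{\mathcal C} = \Big\{(R_1,\dots,R_K)\in\mathbb R^K : \sum_{i\in\mathcal I} R_i \le \tfrac12 \log_2\Big(1+\sum_{i\in\mathcal I}\mathbb E[E_i]\Big)\ \text{ for every } \mathcal I\subseteq\{1,\dots,K\}\Big\}$$ is the region of the standard Gaussian multiple access channel with average power constraints $\mathbb E[E_i]$. -/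

import Mathlib

open Filter Topology MeasureTheory ProbabilityTheory

/-- The data of a `K`-user energy harvesting Gaussian multiple access channel: finite battery
capacities, finite sets of possible energy arrivals (contained in `[0, battery capacity]`), and an
arbitrary joint probability mass function of the energy arrivals `(E₁, …, E_K)` of one time slot,
each having a positive mean. -/
structure EHMac (K : ℕ) where
  batteryCap : Fin K → ℝ
  alphabet : Fin K → Finset ℝ
  alphabet_nonneg : ∀ i, ∀ e ∈ alphabet i, 0 ≤ e
  alphabet_le : ∀ i, ∀ e ∈ alphabet i, e ≤ batteryCap i
  arrivals : PMF ((i : Fin K) → alphabet i)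
  mean_pos : ∀ i, 0 < ∑ e, (arrivals e).toReal * (e i : ℝ)

/-- The energy `B_t` available in the battery at time `t` (times are `0, …, n - 1`), given the
arrivals `e` and the transmitted symbols `x`: the battery is empty before the transmission and
`B_t = min (B_{t-1} - x_{t-1}² + e_t) cap`. -/
noncomputable def batteryLevel {n : ℕ} (cap : ℝ) (e x : Fin n → ℝ) : (t : ℕ) → t < n → ℝ
  | 0, h => min (0 + e ⟨0, h⟩) cap
  | t + 1, h =>
      min (batteryLevel cap e x t (Nat.lt_of_succ_lt h) - x ⟨t, Nat.lt_of_succ_lt h⟩ ^ 2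
        + e ⟨t + 1, h⟩) cap

namespace EHMac

variable {K : ℕ}

/-- The mean `E[E_i]` of the energy arrivals at transmitter `i`. -/
noncomputable def meanArrival (M : EHMac K) (i : Fin K) : ℝ :=
  ∑ e, (M.arrivals e).toReal * (e i : ℝ)

/-- Encoding functions of blocklength `n` with message sets of sizes `m i`. The symbol sent by
transmitter `i` at time `t` is a function of its message and of its own arrivals up to time `t`,
and the energy constraint `x_t² ≤ B_t` holds for all messages and all arrival sequences. -/
structure Encoders (M : EHMac K) (n : ℕ) (m : Fin K → ℕ) where
  enc : (i : Fin K) → Fin (m i) → (t : Fin n) → ({s : Fin n // s ≤ t} → M.alphabet i) → ℝ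
  feasible : ∀ (i : Fin K) (w : Fin (m i)) (e : Fin n → M.alphabet i) (t : Fin n),
    (enc i w t fun s => e s.1) ^ 2 ≤
      batteryLevel (M.batteryCap i) (fun s => (e s : ℝ)) (fun s => enc i w s fun r => e r.1)
        t.1 t.2

/-- The channel output `Y_t = X_{1t} + … + X_{Kt} + N_t` when the messages `w` are sent, the energy
arrivals are `e` and the noise is `z`. -/
def Encoders.output {M : EHMac K} {n : ℕ} {m : Fin K → ℕ} (f : M.Encoders n m)
    (w : (i : Fin K) → Fin (m i)) (e : Fin n → (i : Fin K) → M.alphabet i) (z : Fin n → ℝ) :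
    Fin n → ℝ :=
  fun t => (∑ i, f.enc i (w i) t fun s => e s.1 i) + z t

/-- The law of the noise: i.i.d. standard Gaussian. -/
noncomputable def noise (n : ℕ) : Measure (Fin n → ℝ) :=
  Measure.pi fun _ => gaussianReal 0 1

/-- A code for the case where the receiver does not observe the energy arrivals. -/
structure TxCode (M : EHMac K) (n : ℕ) (m : Fin K → ℕ) extends M.Encoders n m where
  dec : (Fin n → ℝ) → (i : Fin K) → Fin (m i)
  measurable_dec : Measurable dec

/-- A code for the case where the receiver observes the energy arrivals of all transmitters. -/
structure TxRxCode (M : EHMac K) (n : ℕ) (m : Fin K → ℕ) extends M.Encoders n m where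
  dec : (Fin n → ℝ) → (Fin n → (i : Fin K) → M.alphabet i) → (i : Fin K) → Fin (m i)
  measurable_dec : ∀ e, Measurable fun y => dec y e

/-- Average probability of error: messages uniform, arrivals i.i.d. across time with
probability mass function `M.arrivals`, and noise independent of messages and arrivals. -/
noncomputable def TxCode.errorProb {M : EHMac K} {n : ℕ} {m : Fin K → ℕ}
    (c : M.TxCode n m) : ℝ :=
  (∏ i, (m i : ℝ))⁻¹ * ∑ w : (i : Fin K) → Fin (m i),
    ∑ e : Fin n → (i : Fin K) → M.alphabet i,
      (∏ t, (M.arrivals (e t)).toReal) *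
        (noise n).real {z | c.dec (c.output w e z) ≠ w}

/-- Average probability of error, with the same law of messages, arrivals and noise, when the
decoder also uses the arrivals. -/
noncomputable def TxRxCode.errorProb {M : EHMac K} {n : ℕ} {m : Fin K → ℕ}
    (c : M.TxRxCode n m) : ℝ :=
  (∏ i, (m i : ℝ))⁻¹ * ∑ w : (i : Fin K) → Fin (m i),
    ∑ e : Fin n → (i : Fin K) → M.alphabet i,
      (∏ t, (M.arrivals (e t)).toReal) *
        (noise n).real {z | c.dec (c.output w e z) e ≠ w}

/-- The size `⌊2 ^ (n R_i)⌋` of the message set `{1, 2, …, 2 ^ (n R_i)}`. -/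
noncomputable def numMessages (R : Fin K → ℝ) (n : ℕ) (i : Fin K) : ℕ :=
  ⌊(2 : ℝ) ^ ((n : ℝ) * R i)⌋₊

/-- Achievable rate tuples when the receiver does not observe the energy arrivals. -/
def TxAchievable (M : EHMac K) (R : Fin K → ℝ) : Prop :=
  (∀ i, 0 ≤ R i) ∧ ∃ c : (n : ℕ) → M.TxCode n (numMessages R n),
    Tendsto (fun n => (c n).errorProb) atTop (𝓝 0)

/-- Achievable rate tuples when the receiver observes the energy arrivals. -/
def TxRxAchievable (M : EHMac K) (R : Fin K → ℝ) : Prop :=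
  (∀ i, 0 ≤ R i) ∧ ∃ c : (n : ℕ) → M.TxRxCode n (numMessages R n),
    Tendsto (fun n => (c n).errorProb) atTop (𝓝 0)

/-- The capacity region with energy arrivals observed at the transmitters only. -/
def capacityTx (M : EHMac K) : Set (Fin K → ℝ) :=
  closure {R | M.TxAchievable R}

/-- The capacity region with energy arrivals observed at the transmitters and the receiver. -/
def capacityTxRx (M : EHMac K) : Set (Fin K → ℝ) :=
  closure {R | M.TxRxAchievable R}

/-- The region of the Gaussian multiple access channel with average powers `E[E_i]`. -/
def awgnRegion (M : EHMac K) : Set (Fin K → ℝ) :=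
  {R | ∀ I : Finset (Fin K),
    ∑ i ∈ I, R i ≤ 1 / 2 * Real.logb 2 (1 + ∑ i ∈ I, M.meanArrival i)}

end EHMac

/-! A decoder may ignore the arrivals, which gives the first inclusion. The second is a weak
converse. Once the arrivals are fixed, the code is an ordinary codebook, and the battery lets each
codeword spend at most the energy harvested.

Fano's inequality is replaced by a change of measure (`gaussianMac_fano`). For a message tuple `w`,
compare the output law with a Gaussian law `Q w` of fixed variance `v` in which the users of `I`
send their mean codeword. `Q w` forgets the messages of `I`, so under it they are decoded correctly
with average probability at most `1 / ∏ i ∈ I, m i`. The relative entropy between the laws, averaged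
over messages, is controlled by the energy of the users in `I`, since a variance is at most a second
moment.

The bound is affine in that energy, so averaging over arrivals only needs the means `E[E_i]`; with
`v = 1 + ∑ i ∈ I, E[E_i]` it becomes `n/2 log v + log 2` (`TxRxCode.errorProb_fano`). Dividing by
`n` and letting `n → ∞` gives the rate bound, and the region is closed. -/

/-! ### Change of measure between Gaussian product laws. -/

theorem pi_withDensity_prod {ι : Type*} [Fintype ι] {X : ι → Type*}
    [∀ i, MeasurableSpace (X i)] (μ : (i : ι) → Measure (X i)) [∀ i, IsProbabilityMeasure (μ i)]
    {f : (i : ι) → X i → ENNReal} (hf : ∀ i, Measurable (f i))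
    [∀ i, SigmaFinite ((μ i).withDensity (f i))] :
    (Measure.pi μ).withDensity (fun x => ∏ i, f i (x i)) =
      Measure.pi fun i => (μ i).withDensity (f i) := by
  classical
  refine (Measure.pi_eq fun s hs => ?_).symm
  rw [withDensity_apply _ (.univ_pi hs), ← lintegral_indicator (.univ_pi hs)]
  have hbox : (Set.pi Set.univ s).indicator (fun x => ∏ i, f i (x i)) =
      fun x => ∏ i, (s i).indicator (f i) (x i) := by
    funext x
    by_cases hx : x ∈ Set.pi Set.univ s
    · rw [Set.indicator_of_mem hx]
      exact Finset.prod_congr rfl fun i _ => (Set.indicator_of_mem (hx i trivial) _).symm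
    · rw [Set.indicator_of_notMem hx]
      obtain ⟨i, hi⟩ : ∃ i, x i ∉ s i := by simpa [Set.mem_pi] using hx
      exact (Finset.prod_eq_zero (Finset.mem_univ i) (Set.indicator_of_notMem hi _)).symm
  have hmeas : ∀ i, Measurable ((s i).indicator (f i)) := fun i => (hf i).indicator (hs i)
  have hind : iIndepFun (fun i x => (s i).indicator (f i) (x i)) (Measure.pi μ) :=
    iIndepFun_pi fun i => (hmeas i).aemeasurable
  rw [hbox, lintegral_prod_eq_prod_lintegral_of_indepFun Finset.univ _ hind
    fun i => (hmeas i).comp (measurable_pi_apply i)]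
  refine Finset.prod_congr rfl fun i _ => ?_
  rw [(measurePreserving_eval μ i).lintegral_comp (hmeas i), lintegral_indicator (hs i),
    withDensity_apply _ (hs i)]

/-- The likelihood ratio of two Gaussian laws, the second one of variance `1`. -/
noncomputable def gaussianRatio (μ : ℝ) (v : NNReal) (x y : ℝ) : ℝ :=
  gaussianPDFReal μ v y / gaussianPDFReal x 1 y

theorem gaussianRatio_pos (μ : ℝ) {v : NNReal} (hv : v ≠ 0) (x y : ℝ) :
    0 < gaussianRatio μ v x y :=
  div_pos (gaussianPDFReal_pos _ _ _ hv) (gaussianPDFReal_pos _ _ _ one_ne_zero)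

theorem measurable_gaussianRatio (μ : ℝ) (v : NNReal) (x : ℝ) :
    Measurable (gaussianRatio μ v x) :=
  (measurable_gaussianPDFReal μ v).div (measurable_gaussianPDFReal x 1)

theorem gaussianReal_eq_withDensity_gaussianRatio (μ : ℝ) {v : NNReal} (hv : v ≠ 0) (x : ℝ) :
    (gaussianReal x 1).withDensity (fun y => ENNReal.ofReal (gaussianRatio μ v x y)) =
      gaussianReal μ v := by
  rw [gaussianReal_of_var_ne_zero μ hv, gaussianReal_of_var_ne_zero x one_ne_zero,
    ← withDensity_mul _ (measurable_gaussianPDF x 1)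
      (measurable_gaussianRatio μ v x).ennreal_ofReal]
  congr 1
  funext y
  have h := gaussianPDFReal_pos x 1 y one_ne_zero
  rw [Pi.mul_apply, gaussianPDF, gaussianPDF, ← ENNReal.ofReal_mul h.le, gaussianRatio,
    mul_div_cancel₀ _ h.ne']

theorem log_gaussianRatio (μ : ℝ) {v : NNReal} (hv : v ≠ 0) (x y : ℝ) :
    Real.log (gaussianRatio μ v x y) =
      (y - x) ^ 2 / 2 - (y - μ) ^ 2 / (2 * v) - 1 / 2 * Real.log v := by
  have hv' : (0 : ℝ) < v := by positivity
  have hπ := Real.pi_pos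
  rw [gaussianRatio, gaussianPDFReal, gaussianPDFReal,
    Real.log_div (by positivity) (by simp [Real.sqrt_ne_zero', hπ]),
    Real.log_mul (by positivity) (by positivity),
    Real.log_mul (by simp [Real.sqrt_ne_zero', hπ]) (by positivity),
    Real.log_exp, Real.log_exp, Real.log_inv, Real.log_inv, Real.log_sqrt (by positivity),
    Real.log_sqrt (by positivity), Real.log_mul (by positivity) hv'.ne']
  simp
  ring

theorem integrable_sq_sub_gaussianReal (x c : ℝ) (v : NNReal) :
    Integrable (fun y => (y - c) ^ 2) (gaussianReal x v) :=
  ((memLp_id_gaussianReal 2).sub (memLp_const c)).integrable_sq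

theorem integral_sq_sub_gaussianReal (x c : ℝ) (v : NNReal) :
    ∫ y, (y - c) ^ 2 ∂gaussianReal x v = v + (x - c) ^ 2 := by
  have h1 : Integrable (fun y : ℝ => y) (gaussianReal x v) :=
    (memLp_id_gaussianReal 1).integrable le_rfl
  have h2 : ∫ y, (y - x) ^ 2 ∂gaussianReal x v = v := by
    have h := variance_fun_id_gaussianReal (μ := x) (v := v)
    rwa [variance_eq_integral (by fun_prop), integral_id_gaussianReal] at h
  have h3 : (fun y : ℝ => (y - c) ^ 2) =
      fun y => (y - x) ^ 2 + ((2 * (x - c)) * y - (2 * (x - c) * x - (x - c) ^ 2)) := by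
    funext y; ring
  have h4 : Integrable (fun y : ℝ => (2 * (x - c)) * y - (2 * (x - c) * x - (x - c) ^ 2))
      (gaussianReal x v) := (h1.const_mul _).sub (integrable_const _)
  rw [h3, integral_add (integrable_sq_sub_gaussianReal x x v) h4, h2,
    integral_sub (h1.const_mul _) (integrable_const _), integral_const_mul,
    integral_id_gaussianReal]
  simp

theorem integrable_log_gaussianRatio (μ : ℝ) {v : NNReal} (hv : v ≠ 0) (x : ℝ) :
    Integrable (fun y => Real.log (gaussianRatio μ v x y)) (gaussianReal x 1) := by
  simp_rw [log_gaussianRatio μ hv]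
  exact (((integrable_sq_sub_gaussianReal x x 1).div_const _).sub
    ((integrable_sq_sub_gaussianReal x μ 1).div_const _)).sub (integrable_const _)

theorem integral_log_gaussianRatio (μ : ℝ) {v : NNReal} (hv : v ≠ 0) (x : ℝ) :
    ∫ y, Real.log (gaussianRatio μ v x y) ∂gaussianReal x 1 =
      1 / 2 - (1 + (x - μ) ^ 2) / (2 * v) - 1 / 2 * Real.log v := by
  simp_rw [log_gaussianRatio μ hv]
  have h : Integrable (fun y => (y - x) ^ 2 / 2 - (y - μ) ^ 2 / (2 * (v : ℝ)))
      (gaussianReal x 1) :=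
    ((integrable_sq_sub_gaussianReal x x 1).div_const _).sub
      ((integrable_sq_sub_gaussianReal x μ 1).div_const _)
  rw [integral_sub h (integrable_const _),
    integral_sub ((integrable_sq_sub_gaussianReal x x 1).div_const _)
    ((integrable_sq_sub_gaussianReal x μ 1).div_const _), integral_div, integral_div,
    integral_sq_sub_gaussianReal, integral_sq_sub_gaussianReal]
  simp

/-- A linearised form of the Donsker-Varadhan inequality for the test function `log m • 1_A`. -/
theorem measureReal_mul_log_add_integral_log_le {Ω : Type*} [MeasurableSpace Ω] {P Q : Measure Ω}
    [IsProbabilityMeasure P] [IsProbabilityMeasure Q] {ℓ : Ω → ℝ} (hℓ : ∀ ω, 0 < ℓ ω)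
    (hm : Measurable ℓ) (hQ : P.withDensity (fun ω => ENNReal.ofReal (ℓ ω)) = Q)
    (hint : Integrable (fun ω => Real.log (ℓ ω)) P) {A : Set Ω} (hA : MeasurableSet A)
    {m : ℝ} (hm1 : 1 ≤ m) :
    P.real A * Real.log m + ∫ ω, Real.log (ℓ ω) ∂P ≤
      (1 + m * Q.real A) / 2 - 1 + Real.log 2 := by
  have hlin : ∀ B, MeasurableSet B → ∫⁻ ω in B, ENNReal.ofReal (ℓ ω) ∂P = Q B := fun B hB => by
    rw [← hQ, withDensity_apply _ hB]
  have hℓint : Integrable ℓ P := by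
    refine ⟨hm.aestronglyMeasurable, ?_⟩
    rw [hasFiniteIntegral_iff_ofReal (.of_forall fun ω => (hℓ ω).le)]
    have h := hlin _ MeasurableSet.univ
    rw [Measure.restrict_univ] at h
    rw [h]
    exact measure_lt_top _ _
  have hset : ∀ B, MeasurableSet B → ∫ ω in B, ℓ ω ∂P = Q.real B := fun B hB => by
    rw [integral_eq_lintegral_of_nonneg_ae (.of_forall fun ω => (hℓ ω).le)
      hm.aestronglyMeasurable, hlin B hB, measureReal_def]
  have hone : ∫ ω, ℓ ω ∂P = 1 := by simpa using hset _ MeasurableSet.univ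
  have hpt : ∀ ω, A.indicator (fun _ => Real.log m) ω + Real.log (ℓ ω) ≤
      (ℓ ω + m * A.indicator ℓ ω) / 2 - 1 + Real.log 2 := by
    intro ω
    -- Tangent of `log` at `2`: in the application, the average of `1 + m * Q.real A` over messages
    -- is at most `2`, so the linearisation leaves only `log 2`.
    have key : ∀ c : ℝ, 1 ≤ c →
        Real.log c + Real.log (ℓ ω) ≤ c * ℓ ω / 2 - 1 + Real.log 2 := by
      intro c hc
      have hc0 : 0 < c := by linarith
      have h := Real.log_le_sub_one_of_pos (show 0 < c * ℓ ω / 2 from by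
        have := hℓ ω; positivity)
      rw [Real.log_div (mul_pos hc0 (hℓ ω)).ne' two_ne_zero,
        Real.log_mul hc0.ne' (hℓ ω).ne'] at h
      linarith
    by_cases hω : ω ∈ A
    · rw [Set.indicator_of_mem hω, Set.indicator_of_mem hω]
      have := key m hm1
      have := hℓ ω
      linarith
    · rw [Set.indicator_of_notMem hω, Set.indicator_of_notMem hω]
      simpa using key 1 le_rfl
  have hi1 : Integrable (A.indicator fun _ : Ω => Real.log m) P :=
    (integrable_const _).indicator hA
  have hi2 : Integrable (fun ω => ℓ ω + m * A.indicator ℓ ω) P :=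
    hℓint.add ((hℓint.indicator hA).const_mul m)
  have hi3 : Integrable (fun ω => (ℓ ω + m * A.indicator ℓ ω) / 2 - 1) P :=
    (hi2.div_const 2).sub (integrable_const 1)
  have h := integral_mono (hi1.add hint) (hi3.add (integrable_const (Real.log 2))) hpt
  simp only [Pi.add_apply] at h
  rw [integral_add hi1 hint, integral_indicator_const _ hA,
    integral_add hi3 (integrable_const (Real.log 2)),
    integral_sub (hi2.div_const 2) (integrable_const 1), integral_div,
    integral_add hℓint ((hℓint.indicator hA).const_mul m), integral_const_mul,
    integral_indicator hA, hset A hA, hone] at h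
  simpa using h

/-- The sum over `t` is the relative entropy of the two product laws, computed coordinatewise
because the log-likelihood ratio is additive. -/
theorem measureReal_mul_log_le_of_pi_gaussianReal {n : ℕ} (x μ : Fin n → ℝ) {v : NNReal}
    (hv : v ≠ 0) {A : Set (Fin n → ℝ)} (hA : MeasurableSet A) {m : ℝ} (hm : 1 ≤ m) :
    (Measure.pi fun t => gaussianReal (x t) 1).real A * Real.log m ≤
      ∑ t, (1 / 2 * Real.log v + (1 + (x t - μ t) ^ 2) / (2 * v) - 1 / 2) +
        ((1 + m * (Measure.pi fun t => gaussianReal (μ t) v).real A) / 2 - 1 + Real.log 2) := by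
  set P := Measure.pi fun t => gaussianReal (x t) 1 with hP
  have hsum : ∀ t, Integrable (fun y : Fin n → ℝ => Real.log (gaussianRatio (μ t) v (x t) (y t)))
      P := fun t => integrable_comp_eval (μ := fun t => gaussianReal (x t) 1)
        (integrable_log_gaussianRatio (μ t) hv (x t))
  have hlog : (fun y : Fin n → ℝ => Real.log (∏ t, gaussianRatio (μ t) v (x t) (y t))) =
      fun y => ∑ t, Real.log (gaussianRatio (μ t) v (x t) (y t)) := by
    funext y
    exact Real.log_prod fun t _ => (gaussianRatio_pos _ hv _ _).ne'
  have hdens : P.withDensity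
      (fun y => ENNReal.ofReal (∏ t, gaussianRatio (μ t) v (x t) (y t))) =
      Measure.pi fun t => gaussianReal (μ t) v := by
    have hfin : ∀ t, SigmaFinite ((gaussianReal (x t) 1).withDensity
        fun y => ENNReal.ofReal (gaussianRatio (μ t) v (x t) y)) := fun t => by
      rw [gaussianReal_eq_withDensity_gaussianRatio _ hv]; infer_instance
    simp_rw [ENNReal.ofReal_prod_of_nonneg fun t _ => (gaussianRatio_pos _ hv _ _).le]
    rw [hP, pi_withDensity_prod (fun t => gaussianReal (x t) 1)
      (f := fun t y => ENNReal.ofReal (gaussianRatio (μ t) v (x t) y))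
      fun t => (measurable_gaussianRatio _ _ _).ennreal_ofReal]
    simp_rw [gaussianReal_eq_withDensity_gaussianRatio _ hv]
  have h := measureReal_mul_log_add_integral_log_le
    (ℓ := fun y : Fin n → ℝ => ∏ t, gaussianRatio (μ t) v (x t) (y t))
    (fun y => Finset.prod_pos fun t _ => gaussianRatio_pos (μ t) hv (x t) (y t))
    (Finset.measurable_fun_prod _ fun t _ =>
      (measurable_gaussianRatio (μ t) v (x t)).comp (measurable_pi_apply t)) hdens
    (by rw [hlog]; exact integrable_finsetSum _ fun t _ => hsum t) hA hm
  have hval : ∀ t, ∫ y, Real.log (gaussianRatio (μ t) v (x t) (y t)) ∂P =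
      1 / 2 - (1 + (x t - μ t) ^ 2) / (2 * v) - 1 / 2 * Real.log v := fun t => by
    rw [← integral_log_gaussianRatio (μ t) hv (x t)]
    exact integral_comp_eval (μ := fun t => gaussianReal (x t) 1)
      (integrable_log_gaussianRatio (μ t) hv (x t)).aestronglyMeasurable
  rw [hlog, integral_finsetSum _ fun t _ => hsum t, Finset.sum_congr rfl fun t _ => hval t] at h
  have hneg : ∑ t, (1 / 2 * Real.log v + (1 + (x t - μ t) ^ 2) / (2 * (v : ℝ)) - 1 / 2) =
      -∑ t, (1 / 2 - (1 + (x t - μ t) ^ 2) / (2 * (v : ℝ)) - 1 / 2 * Real.log v) := by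
    rw [← Finset.sum_neg_distrib]
    exact Finset.sum_congr rfl fun t _ => by ring
  rw [hneg]
  linarith

/-! ### Moments of independent finite random variables. -/

section ProductWeights

variable {ι : Type*} [Fintype ι] [DecidableEq ι] {α : ι → Type*} [∀ i, Fintype (α i)]
  {p : (i : ι) → α i → ℝ}

theorem sum_prod_weights (hp : ∀ i, ∑ a, p i a = 1) :
    ∑ w : (i : ι) → α i, ∏ i, p i (w i) = 1 := by
  rw [← Fintype.prod_sum]
  simp [hp]

theorem sum_prod_weights_mul_mul (hp : ∀ i, ∑ a, p i a = 1) {i j : ι} (hij : i ≠ j)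
    (f : α i → ℝ) (g : α j → ℝ) :
    ∑ w : (i : ι) → α i, (∏ k, p k (w k)) * (f (w i) * g (w j)) =
      (∑ a, p i a * f a) * ∑ a, p j a * g a := by
  -- Padding `f` and `g` by the constant `1` at the other indices makes the summand a full product;
  -- the casts are needed because `α k` varies with `k`.
  set F : (k : ι) → α k → ℝ := fun k =>
    if h : k = i then fun a => f (h ▸ a) else if h : k = j then fun a => g (h ▸ a) else fun _ => 1
    with hF
  have hFi : F i = f := by funext a; simp [hF]
  have hFj : F j = g := by funext a; simp [hF, hij.symm]
  have hFk : ∀ k, k ≠ i ∧ k ≠ j → F k = fun _ => 1 := fun k hk => by simp [hF, hk.1, hk.2]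
  have hw : ∀ w : (i : ι) → α i, (∏ k, p k (w k)) * (f (w i) * g (w j)) =
      ∏ k, p k (w k) * F k (w k) := fun w => by
    rw [Finset.prod_mul_distrib, Fintype.prod_eq_mul (f := fun k => F k (w k)) i j hij
      fun k hk => by rw [hFk k hk], hFi, hFj]
  rw [Finset.sum_congr rfl fun w _ => hw w, ← Fintype.prod_sum fun k a => p k a * F k a,
    Fintype.prod_eq_mul i j hij fun k hk => by simp [hFk k hk, hp], hFi, hFj]

theorem sum_prod_weights_mul (hp : ∀ i, ∑ a, p i a = 1) (i : ι) (f : α i → ℝ) :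
    ∑ w : (i : ι) → α i, (∏ k, p k (w k)) * f (w i) = ∑ a, p i a * f a := by
  set F : (k : ι) → α k → ℝ := fun k =>
    if h : k = i then fun a => f (h ▸ a) else fun _ => 1 with hF
  have hFi : F i = f := by funext a; simp [hF]
  have hFk : ∀ k, k ≠ i → F k = fun _ => 1 := fun k hk => by simp [hF, hk]
  have hw : ∀ w : (i : ι) → α i, (∏ k, p k (w k)) * f (w i) =
      ∏ k, p k (w k) * F k (w k) := fun w => by
    rw [Finset.prod_mul_distrib, Fintype.prod_eq_single (f := fun k => F k (w k)) i
      fun k hk => by rw [hFk k hk], hFi]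
  rw [Finset.sum_congr rfl fun w _ => hw w, ← Fintype.prod_sum fun k a => p k a * F k a,
    Fintype.prod_eq_single i fun k hk => by simp [hFk k hk, hp], hFi]

/-- The variance of a sum of independent variables is at most the sum of the second moments. -/
theorem sum_prod_weights_mul_sq_le (hp : ∀ i, ∑ a, p i a = 1) (I : Finset ι)
    (x : (i : ι) → α i → ℝ) :
    ∑ w : (i : ι) → α i, (∏ k, p k (w k)) * (∑ i ∈ I, (x i (w i) - ∑ a, p i a * x i a)) ^ 2 ≤
      ∑ i ∈ I, ∑ a, p i a * x i a ^ 2 := by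
  set d : (i : ι) → α i → ℝ := fun i a => x i a - ∑ b, p i b * x i b with hd
  have hd0 : ∀ i, ∑ a, p i a * d i a = 0 := fun i => by
    simp [hd, mul_sub, Finset.sum_sub_distrib, ← Finset.sum_mul, hp]
  have hd2 : ∀ i, ∑ a, p i a * d i a ^ 2 ≤ ∑ a, p i a * x i a ^ 2 := fun i => by
    have h : ∑ a, p i a * d i a ^ 2 =
        ∑ a, p i a * x i a ^ 2 - (∑ a, p i a * x i a) ^ 2 := by
      set μ := ∑ b, p i b * x i b with hμ
      have : ∀ a, p i a * d i a ^ 2 =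
          p i a * x i a ^ 2 - p i a * x i a * (2 * μ) + p i a * μ ^ 2 := fun a => by
        simp only [hd, ← hμ]; ring
      rw [Finset.sum_congr rfl fun a _ => this a, Finset.sum_add_distrib,
        Finset.sum_sub_distrib, ← Finset.sum_mul, ← Finset.sum_mul, hp, ← hμ]
      ring
    rw [h]
    linarith [sq_nonneg (∑ a, p i a * x i a)]
  -- Independence and centring kill the cross terms.
  have hterm : ∀ i j, ∑ w : (i : ι) → α i, (∏ k, p k (w k)) * (d i (w i) * d j (w j)) =
      if i = j then ∑ a, p i a * d i a ^ 2 else 0 := fun i j => by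
    split_ifs with h
    · subst h
      simp_rw [← sq]
      exact sum_prod_weights_mul hp i fun a => d i a ^ 2
    · rw [sum_prod_weights_mul_mul hp h, hd0, zero_mul]
  calc
    _ = ∑ w : (i : ι) → α i, ∑ i ∈ I, ∑ j ∈ I,
        (∏ k, p k (w k)) * (d i (w i) * d j (w j)) := by
      refine Finset.sum_congr rfl fun w _ => ?_
      rw [sq, Finset.sum_mul_sum, Finset.mul_sum]
      exact Finset.sum_congr rfl fun i _ => Finset.mul_sum ..
    _ = ∑ i ∈ I, ∑ j ∈ I, ∑ w : (i : ι) → α i,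
        (∏ k, p k (w k)) * (d i (w i) * d j (w j)) := by
      rw [Finset.sum_comm]
      exact Finset.sum_congr rfl fun i _ => Finset.sum_comm
    _ = ∑ i ∈ I, ∑ a, p i a * d i a ^ 2 := by
      simp_rw [hterm]
      exact Finset.sum_congr rfl fun i hi => by simp [hi]
    _ ≤ _ := Finset.sum_le_sum fun i _ => hd2 i

end ProductWeights

/-! ### Guessing bound and energy budget. -/

/-- Group the `w` by their coordinates outside `I`. Within a group all `Q w` coincide and the events
`g = w` are disjoint, so each group contributes at most `1`. -/
theorem sum_measureReal_preimage_le {ι : Type*} [Fintype ι] [DecidableEq ι] {α : ι → Type*}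
    [∀ i, Fintype (α i)] [∀ i, DecidableEq (α i)] [∀ i, MeasurableSpace (α i)]
    [∀ i, MeasurableSingletonClass (α i)] {Ω : Type*} [MeasurableSpace Ω] (I : Finset ι)
    (Q : ((i : ι) → α i) → Measure Ω) [∀ w, IsProbabilityMeasure (Q w)]
    (hQ : ∀ w w', (∀ i ∉ I, w i = w' i) → Q w = Q w') {g : Ω → (i : ι) → α i}
    (hg : Measurable g) :
    ∑ w, (Q w).real (g ⁻¹' {w}) ≤ ∏ i ∈ Iᶜ, (Fintype.card (α i) : ℝ) := by
  set r : ((i : ι) → α i) → (i : {i // i ∈ Iᶜ}) → α i := fun w i => w i with hr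
  rw [← Finset.sum_fiberwise Finset.univ r]
  have hfib : ∀ u, ∑ w with r w = u, (Q w).real (g ⁻¹' {w}) ≤ 1 := fun u => by
    by_cases hu : ∃ w₀, r w₀ = u
    · obtain ⟨w₀, hw₀⟩ := hu
      have hsame : ∀ w ∈ Finset.univ.filter (r · = u), (Q w).real (g ⁻¹' {w}) =
          (Q w₀).real (g ⁻¹' {w}) := fun w hw => by
        rw [hQ w w₀ fun i hi => ?_]
        have := congrFun ((Finset.mem_filter.1 hw).2.trans hw₀.symm)
          ⟨i, Finset.mem_compl.2 hi⟩
        exact this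
      rw [Finset.sum_congr rfl hsame, sum_measureReal_preimage_singleton _
        fun w _ => hg (measurableSet_singleton w)]
      exact measureReal_le_one
    · rw [Finset.sum_eq_zero fun w hw => (hu ⟨w, (Finset.mem_filter.1 hw).2⟩).elim]
      exact zero_le_one
  refine (Finset.sum_le_sum fun u _ => hfib u).trans_eq ?_
  rw [Finset.sum_const, nsmul_one, Finset.card_univ, Fintype.card_pi, Nat.cast_prod,
    ← Finset.prod_coe_sort Iᶜ]

/-- Energy conservation: overflow at the cap can only lose energy. The level at `t` counts arrivals
through `t` but only symbols before `t`. -/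
theorem batteryLevel_add_sum_sq_le {n : ℕ} (cap : ℝ) (e x : Fin n → ℝ) (t : ℕ) (ht : t < n) :
    batteryLevel cap e x t ht +
        ∑ s ∈ Finset.range t, (if h : s < n then x ⟨s, h⟩ ^ 2 else 0) ≤
      ∑ s ∈ Finset.range (t + 1), (if h : s < n then e ⟨s, h⟩ else 0) := by
  induction t with
  | zero => simp [batteryLevel, ht]
  | succ t ih =>
    have h := ih (Nat.lt_of_succ_lt ht)
    rw [Finset.sum_range_succ, Finset.sum_range_succ _ (t + 1), dif_pos ht,
      dif_pos (Nat.lt_of_succ_lt ht), batteryLevel]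
    have := min_le_left (batteryLevel cap e x t (Nat.lt_of_succ_lt ht) -
      x ⟨t, Nat.lt_of_succ_lt ht⟩ ^ 2 + e ⟨t + 1, ht⟩) cap
    linarith

theorem sum_sq_le_of_le_batteryLevel {n : ℕ} {cap : ℝ} {e x : Fin n → ℝ}
    (hx : ∀ t : Fin n, x t ^ 2 ≤ batteryLevel cap e x t.1 t.2) :
    ∑ t, x t ^ 2 ≤ ∑ t, e t := by
  cases n with
  | zero => simp
  | succ n =>
    have h := batteryLevel_add_sum_sq_le cap e x n n.lt_succ_self
    -- The constraint on the last symbol supplies the one square missing from the energy balance.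
    have h' := hx (Fin.last n)
    rw [Finset.sum_range, Finset.sum_range] at h
    rw [Fin.sum_univ_castSucc]
    have h1 : ∑ i : Fin n, (if h : (i : ℕ) < n + 1 then x ⟨i, h⟩ ^ 2 else 0) =
        ∑ i : Fin n, x i.castSucc ^ 2 :=
      Finset.sum_congr rfl fun i _ => dif_pos (Nat.lt_succ_of_lt i.2)
    have h2 : ∑ i : Fin (n + 1), (if h : (i : ℕ) < n + 1 then e ⟨i, h⟩ else 0) = ∑ i, e i :=
      Finset.sum_congr rfl fun i _ => dif_pos i.2
    rw [h1, h2] at h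
    simp only [Fin.val_last] at h'
    have h3 : x (Fin.last n) ^ 2 ≤ batteryLevel cap e x n n.lt_succ_self := h'
    linarith

/-! ### Fano-type bound for a fixed codebook. -/

theorem noise_map_const_add {n : ℕ} (s : Fin n → ℝ) :
    (EHMac.noise n).map (fun z t => s t + z t) = Measure.pi fun t => gaussianReal (s t) 1 := by
  rw [EHMac.noise, Measure.pi_map_pi (f := fun t z => s t + z) fun t => by fun_prop]
  simp_rw [gaussianReal_map_const_add, zero_add]

theorem noise_real_ne {n : ℕ} {β : Type*} [MeasurableSpace β] [MeasurableSingletonClass β]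
    (s : Fin n → ℝ) {g : (Fin n → ℝ) → β} (hg : Measurable g) (w : β) :
    (EHMac.noise n).real {z | g (fun t => s t + z t) ≠ w} =
      1 - (Measure.pi fun t => gaussianReal (s t) 1).real (g ⁻¹' {w}) := by
  have hA : MeasurableSet (g ⁻¹' {w}) := hg (measurableSet_singleton w)
  rw [← probReal_compl_eq_one_sub hA, ← noise_map_const_add s,
    map_measureReal_apply (by fun_prop) hA.compl]
  rfl

theorem prod_mul_prod_compl_natCast {ι : Type*} [Fintype ι] [DecidableEq ι] (m : ι → ℕ)
    (hm : ∀ i, 0 < m i) (I : Finset ι) :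
    (∏ i, (m i : ℝ))⁻¹ * ((∏ i ∈ I, (m i : ℝ)) * ∏ i ∈ Iᶜ, (m i : ℝ)) = 1 := by
  rw [Finset.prod_mul_prod_compl]
  exact inv_mul_cancel₀ (Finset.prod_ne_zero_iff.2 fun i _ => by exact_mod_cast (hm i).ne')

/-- Fano's inequality for a codebook of the Gaussian multiple access channel and the messages of
the transmitters in `I`, with mutual information bounded through an auxiliary Gaussian output law
of variance `v`. -/
theorem gaussianMac_fano {K n : ℕ} {m : Fin K → ℕ} (hm : ∀ i, 0 < m i)
    (x : (i : Fin K) → Fin (m i) → Fin n → ℝ) {g : (Fin n → ℝ) → (i : Fin K) → Fin (m i)}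
    (hg : Measurable g) (I : Finset (Fin K)) {S : ℝ}
    (hS : ∀ w : (i : Fin K) → Fin (m i), ∑ i ∈ I, ∑ t, x i (w i) t ^ 2 ≤ S)
    {v : NNReal} (hv : v ≠ 0) :
    (1 - (∏ i, (m i : ℝ))⁻¹ * ∑ w : (i : Fin K) → Fin (m i),
        (EHMac.noise n).real {z | g (fun t => (∑ i, x i (w i) t) + z t) ≠ w}) *
        Real.log (∏ i ∈ I, (m i : ℝ)) ≤
      n * (1 / 2 * Real.log v - 1 / 2) + (n + S) / (2 * v) + Real.log 2 := by
  set p : (i : Fin K) → Fin (m i) → ℝ := fun i _ => (m i : ℝ)⁻¹ with hp_def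
  have hm' : ∀ i, (m i : ℝ) ≠ 0 := fun i => by exact_mod_cast (hm i).ne'
  have hp : ∀ i, ∑ a, p i a = 1 := fun i => by simp [hp_def, hm']
  set U : ℝ := (∏ i, (m i : ℝ))⁻¹ with hU
  have hU0 : 0 ≤ U := by positivity
  have hUp : ∀ w : (i : Fin K) → Fin (m i), ∏ i, p i (w i) = U := fun w => by
    rw [hU, ← Finset.prod_inv_distrib]
  have hU1 : ∑ _w : (i : Fin K) → Fin (m i), U = 1 := by
    rw [← sum_prod_weights hp]
    exact Finset.sum_congr rfl fun w _ => (hUp w).symm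
  set M : ℝ := ∏ i ∈ I, (m i : ℝ) with hM
  have hM1 : 1 ≤ M := by
    rw [hM, ← Nat.cast_prod]
    exact_mod_cast Finset.prod_pos fun i _ => hm i
  set s : ((i : Fin K) → Fin (m i)) → Fin n → ℝ := fun w t => ∑ i, x i (w i) t with hs
  -- Centre of the auxiliary law: actual signals outside `I`, mean codewords inside.
  set μ : ((i : Fin K) → Fin (m i)) → Fin n → ℝ := fun w t =>
    ∑ i ∈ Iᶜ, x i (w i) t + ∑ i ∈ I, ∑ a, p i a * x i a t with hμ
  have hsμ : ∀ w t, s w t - μ w t = ∑ i ∈ I, (x i (w i) t - ∑ a, p i a * x i a t) :=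
    fun w t => by
      simp only [hs, hμ]
      rw [← Finset.sum_add_sum_compl I, Finset.sum_sub_distrib]
      ring
  set Q : ((i : Fin K) → Fin (m i)) → Measure (Fin n → ℝ) := fun w =>
    Measure.pi fun t => gaussianReal (μ w t) v with hQ
  have hQprob : ∀ w, IsProbabilityMeasure (Q w) := fun w => by
    simp only [hQ]; infer_instance
  have hQdisj : ∑ w, (Q w).real (g ⁻¹' {w}) ≤ ∏ i ∈ Iᶜ, (m i : ℝ) := by
    refine (sum_measureReal_preimage_le I Q (fun w w' hww => ?_) hg).trans_eq (by simp)
    have : μ w = μ w' := by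
      funext t
      simp only [hμ]
      congr 1
      exact Finset.sum_congr rfl fun i hi => by rw [hww i (Finset.mem_compl.1 hi)]
    simp only [hQ, this]
  have hword : ∀ w : (i : Fin K) → Fin (m i),
      (1 - (EHMac.noise n).real {z | g (fun t => s w t + z t) ≠ w}) * Real.log M ≤
        n * (1 / 2 * Real.log v - 1 / 2) + (n + ∑ t, (s w t - μ w t) ^ 2) / (2 * v) +
          ((1 + M * (Q w).real (g ⁻¹' {w})) / 2 - 1 + Real.log 2) := fun w => by
    rw [noise_real_ne _ hg, sub_sub_cancel]
    refine (measureReal_mul_log_le_of_pi_gaussianReal (s w) (μ w) hv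
      (hg (measurableSet_singleton w)) hM1).trans_eq ?_
    congr 1
    rw [Finset.sum_sub_distrib, Finset.sum_add_distrib, ← Finset.sum_div,
      Finset.sum_add_distrib]
    simp
    ring
  have hvar : ∑ w, U * ∑ t, (s w t - μ w t) ^ 2 ≤ S := by
    calc
      ∑ w, U * ∑ t, (s w t - μ w t) ^ 2 = ∑ t, ∑ w : (i : Fin K) → Fin (m i),
          (∏ i, p i (w i)) * (∑ i ∈ I, (x i (w i) t - ∑ a, p i a * x i a t)) ^ 2 := by
        simp_rw [Finset.mul_sum]
        rw [Finset.sum_comm]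
        simp_rw [hsμ, hUp]
      _ ≤ ∑ t, ∑ i ∈ I, ∑ a, p i a * x i a t ^ 2 :=
        Finset.sum_le_sum fun t _ => sum_prod_weights_mul_sq_le hp I fun i a => x i a t
      -- Back to averages over full message tuples, since `hS` bounds the energy tuple by tuple.
      _ = ∑ t, ∑ i ∈ I, ∑ w : (i : Fin K) → Fin (m i), (∏ k, p k (w k)) * x i (w i) t ^ 2 := by
        refine Finset.sum_congr rfl fun t _ => Finset.sum_congr rfl fun i _ => ?_
        exact (sum_prod_weights_mul hp i fun a => x i a t ^ 2).symm
      _ = ∑ w : (i : Fin K) → Fin (m i), U * ∑ i ∈ I, ∑ t, x i (w i) t ^ 2 := by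
        simp_rw [hUp, Finset.mul_sum]
        rw [Finset.sum_comm]
        simp_rw [Finset.sum_comm (s := (Finset.univ : Finset (Fin n)))]
        rw [Finset.sum_comm]
      _ ≤ ∑ _w : (i : Fin K) → Fin (m i), U * S :=
        Finset.sum_le_sum fun w _ => mul_le_mul_of_nonneg_left (hS w) hU0
      _ = S := by rw [← Finset.sum_mul, hU1, one_mul]
  have hQU : ∑ w, U * (M * (Q w).real (g ⁻¹' {w})) ≤ 1 := by
    rw [← prod_mul_prod_compl_natCast m hm I, ← Finset.mul_sum, ← Finset.mul_sum]
    gcongr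
  have hv' : (0 : ℝ) < v := by positivity
  have hsum := Finset.sum_le_sum fun w (_ : w ∈ Finset.univ) =>
    mul_le_mul_of_nonneg_left (hword w) hU0
  have hL : ∑ w : (i : Fin K) → Fin (m i), U *
      ((1 - (EHMac.noise n).real {z | g (fun t => s w t + z t) ≠ w}) * Real.log M) =
      (1 - U * ∑ w : (i : Fin K) → Fin (m i),
        (EHMac.noise n).real {z | g (fun t => s w t + z t) ≠ w}) * Real.log M := by
    simp_rw [← mul_assoc, mul_sub, mul_one, ← Finset.sum_mul]
    rw [Finset.sum_sub_distrib, hU1, Finset.mul_sum]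
  have hR : ∑ w : (i : Fin K) → Fin (m i), U *
      (n * (1 / 2 * Real.log v - 1 / 2) + (n + ∑ t, (s w t - μ w t) ^ 2) / (2 * v) +
          ((1 + M * (Q w).real (g ⁻¹' {w})) / 2 - 1 + Real.log 2)) =
      (∑ w : (i : Fin K) → Fin (m i), U) * (n * (1 / 2 * Real.log v - 1 / 2)) +
        ((∑ w : (i : Fin K) → Fin (m i), U) * n + ∑ w, U * ∑ t, (s w t - μ w t) ^ 2) / (2 * v) +
        (((∑ w : (i : Fin K) → Fin (m i), U) + ∑ w, U * (M * (Q w).real (g ⁻¹' {w}))) / 2 +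
          (∑ w : (i : Fin K) → Fin (m i), U) * (Real.log 2 - 1)) := by
    simp_rw [Finset.sum_mul, ← Finset.sum_add_distrib, Finset.sum_div, ← Finset.sum_add_distrib]
    exact Finset.sum_congr rfl fun w _ => by ring
  rw [hL, hR, hU1] at hsum
  refine hsum.trans ?_
  have hdiv : ((n : ℝ) + ∑ w, U * ∑ t, (s w t - μ w t) ^ 2) / (2 * v) ≤ (n + S) / (2 * v) := by
    gcongr
  simp only [one_mul]
  linarith

/-! ### Converse for the energy harvesting channel. -/

namespace EHMac

variable {K : ℕ}

theorem Encoders.sum_sq_le {M : EHMac K} {n : ℕ} {m : Fin K → ℕ} (f : M.Encoders n m)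
    (i : Fin K) (w : Fin (m i)) (e : Fin n → M.alphabet i) :
    ∑ t, (f.enc i w t fun s => e s.1) ^ 2 ≤ ∑ t, (e t : ℝ) :=
  sum_sq_le_of_le_batteryLevel (f.feasible i w e)

theorem sum_toReal_arrivals (M : EHMac K) : ∑ e, (M.arrivals e).toReal = 1 := by
  have h := M.arrivals.tsum_coe
  rw [tsum_fintype] at h
  rw [← ENNReal.toReal_sum fun e _ => M.arrivals.apply_ne_top e, h, ENNReal.toReal_one]

theorem TxRxCode.errorProb_fano {M : EHMac K} {n : ℕ} {m : Fin K → ℕ} (hm : ∀ i, 0 < m i)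
    (c : M.TxRxCode n m) (I : Finset (Fin K)) (hpos : 0 < 1 + ∑ i ∈ I, M.meanArrival i) :
    (1 - c.errorProb) * Real.log (∏ i ∈ I, (m i : ℝ)) ≤
      n * (1 / 2 * Real.log (1 + ∑ i ∈ I, M.meanArrival i)) + Real.log 2 := by
  set v : NNReal := ⟨1 + ∑ i ∈ I, M.meanArrival i, hpos.le⟩ with hv_def
  have hv : v ≠ 0 := fun h => hpos.ne' (congrArg NNReal.toReal h)
  have hv_coe : (v : ℝ) = 1 + ∑ i ∈ I, M.meanArrival i := rfl
  set q : (Fin n → (i : Fin K) → M.alphabet i) → ℝ := fun e =>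
    ∏ t, (M.arrivals (e t)).toReal with hq
  have hq0 : ∀ e, 0 ≤ q e := fun e => Finset.prod_nonneg fun t _ => ENNReal.toReal_nonneg
  have hq1 : ∑ e, q e = 1 :=
    sum_prod_weights (p := fun (_ : Fin n) e => (M.arrivals e).toReal)
      fun _ => M.sum_toReal_arrivals
  set ε : (Fin n → (i : Fin K) → M.alphabet i) → ℝ := fun e =>
    (∏ i, (m i : ℝ))⁻¹ * ∑ w : (i : Fin K) → Fin (m i),
      (noise n).real {z | c.dec (c.output w e z) e ≠ w} with hε
  have herr : c.errorProb = ∑ e, q e * ε e := by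
    simp only [TxRxCode.errorProb, hq, hε, Finset.mul_sum]
    rw [Finset.sum_comm]
    exact Finset.sum_congr rfl fun e _ => Finset.sum_congr rfl fun w _ => by ring
  set S : (Fin n → (i : Fin K) → M.alphabet i) → ℝ := fun e =>
    ∑ i ∈ I, ∑ t, (e t i : ℝ) with hS
  have hSmean : ∑ e, q e * S e = n * ∑ i ∈ I, M.meanArrival i := by
    have h : ∀ i t, ∑ e, q e * (e t i : ℝ) = M.meanArrival i := fun i t =>
      sum_prod_weights_mul (p := fun (_ : Fin n) e => (M.arrivals e).toReal)
        (fun _ => M.sum_toReal_arrivals) t fun e => (e i : ℝ)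
    simp only [hS, Finset.mul_sum]
    rw [Finset.sum_comm]
    refine Finset.sum_congr rfl fun i _ => ?_
    rw [Finset.sum_comm, Finset.sum_congr rfl fun t _ => h i t]
    simp
  have hfano : ∀ e, (1 - ε e) * Real.log (∏ i ∈ I, (m i : ℝ)) ≤
      n * (1 / 2 * Real.log v - 1 / 2) + (n + S e) / (2 * v) + Real.log 2 := fun e =>
    -- For fixed `e`, the receiver's knowledge of the arrivals just selects one decoder.
    gaussianMac_fano hm (fun i a t => c.enc i a t fun s => e s.1 i) (c.measurable_dec e) I
      (fun w => Finset.sum_le_sum fun i _ => c.sum_sq_le i (w i) fun t => e t i) hv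
  have hsum := Finset.sum_le_sum fun e (_ : e ∈ Finset.univ) =>
    mul_le_mul_of_nonneg_left (hfano e) (hq0 e)
  have hL : ∑ e, q e * ((1 - ε e) * Real.log (∏ i ∈ I, (m i : ℝ))) =
      (∑ e, q e - ∑ e, q e * ε e) * Real.log (∏ i ∈ I, (m i : ℝ)) := by
    rw [← Finset.sum_sub_distrib, Finset.sum_mul]
    exact Finset.sum_congr rfl fun e _ => by ring
  have hR : ∑ e, q e *
      (n * (1 / 2 * Real.log v - 1 / 2) + (n + S e) / (2 * v) + Real.log 2) =
      (∑ e, q e) * (n * (1 / 2 * Real.log v - 1 / 2)) +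
        ((∑ e, q e) * n + ∑ e, q e * S e) / (2 * v) + (∑ e, q e) * Real.log 2 := by
    simp_rw [Finset.sum_mul, ← Finset.sum_add_distrib, Finset.sum_div, ← Finset.sum_add_distrib]
    exact Finset.sum_congr rfl fun e _ => by ring
  rw [hL, hR, hq1, ← herr, hSmean] at hsum
  refine hsum.trans_eq ?_
  -- The choice of `v` makes this term cancel the `-n / 2` of the relative entropy.
  have hn : (1 * (n : ℝ) + n * ∑ i ∈ I, M.meanArrival i) / (2 * v) = n / 2 := by
    rw [hv_coe]
    field_simp
  rw [hn, ← hv_coe]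
  ring

theorem numMessages_pos {R : Fin K → ℝ} (hR : ∀ i, 0 ≤ R i) (n : ℕ) (i : Fin K) :
    0 < numMessages R n i :=
  Nat.floor_pos.2 (Real.one_le_rpow one_le_two (mul_nonneg n.cast_nonneg (hR i)))

/-- Rounding down a real number that is at least `1` loses at most a factor `2`, negligible after
division by `n`. -/
theorem sub_log_two_le_log_numMessages {R : Fin K → ℝ} (hR : ∀ i, 0 ≤ R i) (n : ℕ) (i : Fin K) :
    n * (R i * Real.log 2) - Real.log 2 ≤ Real.log (numMessages R n i) := by
  have h1 : (1 : ℝ) ≤ numMessages R n i := by exact_mod_cast numMessages_pos hR n i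
  have h2 : (2 : ℝ) ^ ((n : ℝ) * R i) < numMessages R n i + 1 := Nat.lt_floor_add_one _
  have h3 : (2 : ℝ) ^ ((n : ℝ) * R i) / 2 ≤ numMessages R n i := by linarith
  have h4 := Real.log_le_log (by positivity) h3
  rw [Real.log_div (by positivity) two_ne_zero, Real.log_rpow two_pos] at h4
  linarith

theorem TxRxAchievable.mem_awgnRegion {M : EHMac K} {R : Fin K → ℝ} (h : M.TxRxAchievable R) :
    R ∈ M.awgnRegion := by
  intro I
  obtain ⟨hR, c, hc⟩ := h
  set P := ∑ i ∈ I, M.meanArrival i with hP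
  have hpos : 0 < 1 + P := by
    have : 0 ≤ P := Finset.sum_nonneg fun i _ => (M.mean_pos i).le
    linarith
  have hlog2 : 0 < Real.log 2 := Real.log_pos one_lt_two
  have hbound : ∀ᶠ n : ℕ in atTop, (1 - (c n).errorProb) *
      ((∑ i ∈ I, R i) * Real.log 2 - I.card * Real.log 2 * (n : ℝ)⁻¹) ≤
        1 / 2 * Real.log (1 + P) + Real.log 2 * (n : ℝ)⁻¹ := by
    -- Error below `1` keeps the factor `1 - errorProb` nonnegative, so the lower bound on the
    -- message count may be multiplied by it.
    filter_upwards [eventually_gt_atTop 0, hc.eventually (gt_mem_nhds one_pos)] with n hn hε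
    have hn' : (0 : ℝ) < n := by exact_mod_cast hn
    have hfano := (c n).errorProb_fano (numMessages_pos hR n) I hpos
    have hlog : n * ((∑ i ∈ I, R i) * Real.log 2) - I.card * Real.log 2 ≤
        Real.log (∏ i ∈ I, (numMessages R n i : ℝ)) := by
      rw [Real.log_prod fun i _ => by exact_mod_cast (numMessages_pos hR n i).ne']
      refine le_trans (le_of_eq ?_)
        (Finset.sum_le_sum fun i _ => sub_log_two_le_log_numMessages hR n i)
      rw [Finset.sum_sub_distrib, ← Finset.mul_sum, ← Finset.sum_mul]
      simp
    have hmul := (mul_le_mul_of_nonneg_left hlog (sub_nonneg.2 hε.le)).trans hfano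
    have hfinal := mul_le_mul_of_nonneg_right hmul (inv_nonneg.2 hn'.le)
    have e1 : (1 - (c n).errorProb) *
        (n * ((∑ i ∈ I, R i) * Real.log 2) - I.card * Real.log 2) * (n : ℝ)⁻¹ =
        (1 - (c n).errorProb) *
          ((∑ i ∈ I, R i) * Real.log 2 - I.card * Real.log 2 * (n : ℝ)⁻¹) := by
      field_simp
    have e2 : (n * (1 / 2 * Real.log (1 + P)) + Real.log 2) * (n : ℝ)⁻¹ =
        1 / 2 * Real.log (1 + P) + Real.log 2 * (n : ℝ)⁻¹ := by
      field_simp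
    rwa [e1, e2] at hfinal
  have hinv : Tendsto (fun n : ℕ => (n : ℝ)⁻¹) atTop (𝓝 0) := tendsto_inv_atTop_nhds_zero_nat
  have hl := (hc.const_sub 1).mul
    ((hinv.const_mul (I.card * Real.log 2)).const_sub ((∑ i ∈ I, R i) * Real.log 2))
  have hr := (hinv.const_mul (Real.log 2)).const_add (1 / 2 * Real.log (1 + P))
  have hlim := le_of_tendsto_of_tendsto hl hr hbound
  simp only [mul_zero, sub_zero, one_mul, add_zero] at hlim
  rw [Real.logb, ← mul_div_assoc]
  exact (le_div_iff₀ hlog2).2 hlim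

theorem isClosed_awgnRegion (M : EHMac K) : IsClosed M.awgnRegion := by
  simp only [awgnRegion, Set.ofPred_forall]
  exact isClosed_iInter fun I => isClosed_le
    (continuous_finsetSum _ fun i _ => continuous_apply i) continuous_const

/-- A decoder that does not observe the arrivals is a decoder that ignores them. -/
def TxCode.toTxRxCode {M : EHMac K} {n : ℕ} {m : Fin K → ℕ} (c : M.TxCode n m) :
    M.TxRxCode n m where
  toEncoders := c.toEncoders
  dec y _ := c.dec y
  measurable_dec _ := c.measurable_dec

theorem TxAchievable.txRxAchievable {M : EHMac K} {R : Fin K → ℝ} (h : M.TxAchievable R) :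
    M.TxRxAchievable R :=
  ⟨h.1, fun n => (h.2.choose n).toTxRxCode, h.2.choose_spec⟩

end EHMac

theorem mainTheorem7 (K : ℕ) (M : EHMac K) :
    M.capacityTx ⊆ M.capacityTxRx ∧ M.capacityTxRx ⊆ M.awgnRegion :=
  ⟨closure_mono fun _ h => h.txRxAchievable,
    closure_minimal (fun _ h => h.mem_awgnRegion) M.isClosed_awgnRegion⟩
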